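/- A scheme for a search problem on data streams consists of a Verifier and a Prover. The Verifier draws coins $R$ uniformly from a finite set, reads the input stream token by token, and then reads a help message bit by bit (sent by the Prover, who knows the input but not $R$). While reading the help it may write to a write-only output stream, and in the end it accepts (its output being what was written, possibly with some last tokens appended) or rejects. Its space is $v$ bits if its memory takes at most $2^v$ values (for a fixed number $n$ of vertices the Verifier's transition functions, which may depend on $R$, are arbitrary). The scheme uses at most $h$ bits of help, with completeness error $\varepsilon_c$ and soundness error $\varepsilon_s$, if for every input there is a help message of at most $h$ bits for which $\Pr_R[\text{the output is a correct answer}]\ge 1-\varepsilon_c$, and for every input and every help message $\Pr_R[\text{the Verifier accepts with an incorrect output}]\le\varepsilon_s$. In the problem MIS the input is a simple graph $G$ on the vertex set $[n]$ and a correct answer is a list of the vertices of any inclusion-wise maximal independent set of $G$. A vanilla stream lists each edge of $G$ exactly once, in any order. A turnstile stream is a finite sequence of tokens $(u,v,\Delta)$ with $u\ne v$ and $\Delta\in\mathbb Z$, each adding $\Delta$ to the multiplicity of $\{u,v\}$, such that the final multiplicities are $1$ on the edges of $G$ and $0$ elsewhere. Theorem. (i) For all positive integers $n,t,s$ with $ts\ge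 n$ (in particular whenever $ts=n$) there is an $[nt,s]$-scheme for MIS on turnstile streams: there are absolute constants $C,k\in\mathbb N$ such that for all such $n,t,s$ there is a scheme for MIS on $n$-vertex graphs given by turnstile streams with at most $C\,nt\,(\lfloor\log_2 n\rfloor+1)^k$ bits of help, a Verifier whose memory and whose coins each take at most $C\,s\,(\lfloor\log_2 n\rfloor+1)^k$ bits, completeness error $0$ and soundness error $1/3$. (ii) This is optimal up to logarithmic factors, because any $(h,v)$-scheme for MIS requires $hv=\Omega(n^2)$, even on vanilla streams: there is an absolute constant $c>0$ such that for all integers $n\ge 2$, $h\ge 1$, $v\ge 0$, every scheme for MIS on $n$-vertex graphs given by vanilla streams with at most $h$ bits of help, $v$ bits of Verifier memory (coins not counted, in any number), completeness error $1/3$ and soundness error $1/3$ satisfies $hv\ge c\,n^2$. -/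

import Mathlib

/-- A randomized streaming verifier for input tokens in `α` and output tokens in `β`.

It draws its coins uniformly from the finite set `Coins`, reads the input stream token by token,
and then reads the help message (the proof stream) bit by bit.  Its memory always holds one
element of the finite set `State`.  While it reads the help message it may append tokens to a
write-only output stream.  At the end it either rejects (`none`) or accepts, possibly after
appending some last tokens to the output stream. -/
structure Verifier (α β : Type) where
  Coins : Type
  [coinsFintype : Fintype Coins]
  [coinsNonempty : Nonempty Coins]
  State : Type
  [stateFintype : Fintype State]
  init : Coins → State
  read : Coins → State → α → State
  hear : Coins → State → Bool → State × List β
  finish : Coins → State → Option (List β)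

namespace Verifier

attribute [instance] Verifier.coinsFintype Verifier.coinsNonempty Verifier.stateFintype

variable {α β : Type} (V : Verifier α β)

/-- The memory content after the input stream `σ` has been read with coins `r`. -/
def summary (r : V.Coins) (σ : List α) : V.State :=
  σ.foldl (V.read r) (V.init r)

/-- Processing of the help message: from memory content `q`, the result (`none` is "reject")
of reading the bits `w`, where the accepted output is the whole output stream from then on. -/
def out (r : V.Coins) : V.State → List Bool → Option (List β)
  | q, [] => V.finish r q
  | q, b :: w => (out r (V.hear r q b).1 w).map fun l => (V.hear r q b).2 ++ l

/-- The result of the verifier on input stream `σ` and help message `w` with coins `r`. -/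
def result (r : V.Coins) (σ : List α) (w : List Bool) : Option (List β) :=
  V.out r (V.summary r σ) w

/-- The probability of an event over the uniformly random coins of the verifier. -/
noncomputable def prob (E : V.Coins → Prop) : ℝ :=
  (Nat.card {r : V.Coins // E r} : ℝ) / (Fintype.card V.Coins : ℝ)

/-- The memory of the verifier fits into `v` bits (the coins are not counted). -/
def UsesSpace (v : ℕ) : Prop := Fintype.card V.State ≤ 2 ^ v

/-- The coins of the verifier fit into `v` bits. -/
def UsesCoins (v : ℕ) : Prop := Fintype.card V.Coins ≤ 2 ^ v

/-- `V` is the verifier of a scheme with at most `h` bits of help, completeness error `εc` and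
soundness error `εs`, for the following search problem: `enc σ x` says that the stream `σ` is an
admissible presentation of the instance `x`, and `sol x l` that the output stream `l` is a
correct answer for `x`.

Completeness: for every input some help message of at most `h` bits, which does not depend on the
coins, makes the verifier give a correct answer with probability at least `1 - εc`.
Soundness: for every input and every help message whatsoever, the verifier gives an answer that
is neither correct nor "reject" with probability at most `εs`. -/
def IsScheme {ι : Type} (enc : List α → ι → Prop) (sol : ι → List β → Prop)
    (h : ℕ) (εc εs : ℝ) : Prop :=
  ∀ (σ : List α) (x : ι), enc σ x →
    (∃ w : List Bool, w.length ≤ h ∧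
      1 - εc ≤ V.prob fun r => ∃ l, V.result r σ w = some l ∧ sol x l) ∧
    (∀ w : List Bool, V.prob (fun r => ∃ l, V.result r σ w = some l ∧ ¬ sol x l) ≤ εs)

end Verifier

/-- A token `(u, v, Δ)` of a turnstile graph stream on the vertex set `Fin n`: the integer `Δ`
is added to the multiplicity of the undirected edge `{u, v}`. -/
structure EdgeUpdate (n : ℕ) where
  u : Fin n
  v : Fin n
  Δ : ℤ

/-- The multiplicity that the stream `σ` gives to the undirected edge `e`. -/
def edgeMult {n : ℕ} (σ : List (EdgeUpdate n)) (e : Sym2 (Fin n)) : ℤ :=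
  (σ.map fun a => if s(a.u, a.v) = e then a.Δ else 0).sum

/-- The turnstile stream `σ` presents the simple graph `G`: no token is a loop, and in the end the
edges of `G` have multiplicity `1` and all other pairs have multiplicity `0`. -/
def TurnstileStream {n : ℕ} (σ : List (EdgeUpdate n)) (G : SimpleGraph (Fin n)) : Prop :=
  (∀ a ∈ σ, a.u ≠ a.v) ∧
    ∀ e : Sym2 (Fin n), (e ∈ G.edgeSet → edgeMult σ e = 1) ∧
      (e ∉ G.edgeSet → edgeMult σ e = 0)

/-- The vanilla (insertion-only) stream `σ` presents the simple graph `G`: it lists every edge of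
`G` exactly once, in any order and with either orientation. -/
def VanillaStream {n : ℕ} (σ : List (EdgeUpdate n)) (G : SimpleGraph (Fin n)) : Prop :=
  TurnstileStream σ G ∧ ∀ a ∈ σ, a.Δ = 1

/-- The output stream `l` lists the vertices of an inclusion-wise maximal independent set
of `G`. -/
def ListsMIS {n : ℕ} (G : SimpleGraph (Fin n)) (l : List (Fin n)) : Prop :=
  Maximal (fun U : Set (Fin n) => G.IsIndepSet U) {x | x ∈ l}

/-! A set `U` is a maximal independent set iff, for every vertex `v`, `v ∈ U` exactly when `v` has
no neighbour in `U`. So the neighbour counts `∑ u ∈ U, A v u` determine `U` and certify it.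

Upper bound. Write a vertex `u` as a pair `(u / s, u % s)` with `u / s < t`. For each residue class
the graph polynomial has a monomial `X ^ (2tv + u/s)` per adjacent pair, and the set polynomial has
`X ^ (t-1-u'/s)` per `u' ∈ U`. In the sum over the classes of the products, the coefficient at `2tv
+ t-1` is the count of `v` (`coeff_targetPoly`), and the degree is below `2tn`. The help lists all
coefficients; the Verifier outputs `v` iff the claimed count vanishes, and compares claim and
product at a random point `r` of `ZMod p`, keeping only about `2s` field elements. The output
depends on the help alone, so if it is wrong, the claimed polynomial differs from the true one, and
the two agree on fewer than `2tn ≤ p / 3` points.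

Lower bound. This is a reduction from the index problem on `m × m` bits. The data are two copies of
a bipartite graph encoding `x`; a query `κ` joins the copies completely except at the ends of `κ`. A
maximal independent set has non-ends in at most one copy, so in the other copy it reveals whether
`κ` is an edge (`exists_copy_iff`). Running `O(h)` independent copies of the Verifier makes the
error smaller than the number of help messages, so a union bound turns the scheme into a code that
recovers most bits with `O(hv)` bits of memory; counting gives `hv = Ω(m²)`. -/

/-! ### Verifiers, maximal independent sets and linear functionals of a stream -/

namespace Verifier

variable {α β : Type}

/-- If the verifier simulates the deterministic machine `step` through `abs`, and `em` is what it
has written so far, then its result is determined by the final state of that machine. -/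
theorem out_of_simulation (V : Verifier α β) (r : V.Coins) {S : Type} (step : S → Bool → S)
    (abs : S → V.State) (em : S → List β)
    (hstep : ∀ p b, abs (step p b) = (V.hear r (abs p) b).1)
    (hem : ∀ p b, em (step p b) = em p ++ (V.hear r (abs p) b).2) (w : List Bool) (p : S) :
    (V.out r (abs p) w).map (em p ++ ·) =
      (V.finish r (abs (w.foldl step p))).map (em (w.foldl step p) ++ ·) := by
  induction w generalizing p with
  | nil => simp [out]
  | cons b w ih =>
    rw [List.foldl_cons, ← ih (step p b), out, ← hstep, Option.map_map]
    congr 1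
    funext l
    simp [hem]

end Verifier

/-- A set of vertices of a graph is a maximal independent set when its members are exactly the
vertices without neighbours in it. -/
theorem maximal_isIndepSet_iff {V : Type*} (G : SimpleGraph V) (U : Set V) :
    Maximal (fun U : Set V => G.IsIndepSet U) U ↔ ∀ v, v ∈ U ↔ ∀ u ∈ U, ¬ G.Adj v u := by
  constructor
  · intro h v
    constructor
    · intro hv u hu hadj
      exact h.prop hv hu hadj.ne hadj
    · intro hv
      have hins : G.IsIndepSet (insert v U) := by
        intro a ha b hb hab
        rcases ha with rfl | ha
        · rcases hb with rfl | hb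
          · exact (hab rfl).elim
          · exact hv b hb
        · rcases hb with rfl | hb
          · exact fun hadj => hv a ha hadj.symm
          · exact h.prop ha hb hab
      exact h.le_of_ge hins (Set.subset_insert v U) (Set.mem_insert v U)
  · intro h
    refine ⟨fun a ha b hb _ => (h a).1 ha b hb, fun W hW hUW v hv => ?_⟩
    rw [h]
    intro u hu hadj
    exact hW hv (hUW hu) hadj.ne hadj

theorem edgeMult_cons {n : ℕ} (a : EdgeUpdate n) (σ : List (EdgeUpdate n)) (e : Sym2 (Fin n)) :
    edgeMult (a :: σ) e = (if s(a.u, a.v) = e then a.Δ else 0) + edgeMult σ e := by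
  simp [edgeMult]

/-- A linear functional of the final adjacency matrix is computed token by token. -/
theorem sum_edgeMult_mul {n : ℕ} {F : Type*} [CommRing F] (φ : Fin n → Fin n → F)
    (σ : List (EdgeUpdate n)) (hσ : ∀ a ∈ σ, a.u ≠ a.v) :
    ∑ v, ∑ u, (edgeMult σ s(v, u) : F) * φ v u =
      (σ.map fun a => (a.Δ : F) * (φ a.u a.v + φ a.v a.u)).sum := by
  induction σ with
  | nil => simp [edgeMult]
  | cons a σ ih =>
    have hne : a.u ≠ a.v := hσ a (by simp)
    rw [List.map_cons, List.sum_cons, ← ih fun b hb => hσ b (by simp [hb])]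
    have hterm : ∀ v u, (((if s(a.u, a.v) = s(v, u) then a.Δ else 0 : ℤ)) : F) * φ v u =
        (if v = a.u then if u = a.v then (a.Δ : F) * φ v u else 0 else 0) +
        (if v = a.v then if u = a.u then (a.Δ : F) * φ v u else 0 else 0) := by
      intro v u
      simp only [Sym2.eq_iff]
      by_cases h1 : v = a.u <;> by_cases h2 : u = a.v <;> by_cases h3 : v = a.v <;>
        by_cases h4 : u = a.u <;> simp_all [eq_comm]
    simp only [edgeMult_cons, Int.cast_add, add_mul, Finset.sum_add_distrib, hterm]
    simp [mul_add]

/-! ### The Verifier of the upper bound and its result -/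

namespace MISScheme

variable {n p : ℕ}

/-- The vertex, if any, that coefficient number `k` with value `c` of the help puts into the
output. -/
def emit (n t : ℕ) (k : ℕ) (c : ZMod p) : List (Fin n) :=
  if h : k / (2 * t) < n then
    if k % (2 * t) = t - 1 ∧ c = 0 then [⟨k / (2 * t), h⟩] else []
  else []

/-- The vertices output after the coefficients `c 0, …, c (i - 1)`. -/
def emitted (n t : ℕ) (i : ℕ) (c : ℕ → ZMod p) : List (Fin n) :=
  (List.range i).flatMap fun k => emit n t k (c k)

/-- The polynomials of the output set, evaluated at `r`. -/
def outMass (t s : ℕ) (r : ZMod p) (l : List (Fin n)) (y : Fin s) : ZMod p :=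
  (l.map fun v : Fin n => if (v : ℕ) % s = y then r ^ (t - 1 - v / s) else 0).sum

/-- The monomial of the matrix entry `(v, u)`, evaluated at `r`. -/
def edgeWeight (t s : ℕ) (r : ZMod p) (y : Fin s) (v u : Fin n) : ZMod p :=
  if (u : ℕ) % s = y then r ^ (2 * t * v + u / s) else 0

/-- One step of parsing the help into `N` coefficients of `b + 1` bits each: the number of
complete coefficients, the number of bits of the current one, its value so far, and the complete
coefficients. -/
def parseStep (N b : ℕ) (q : Fin (N + 1) × Fin (b + 1) × ZMod p × (ℕ → ZMod p)) (bit : Bool) :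
    Fin (N + 1) × Fin (b + 1) × ZMod p × (ℕ → ZMod p) :=
  if hi : (q.1 : ℕ) < N then
    if hj : (q.2.1 : ℕ) < b then
      (q.1, ⟨q.2.1 + 1, by omega⟩, q.2.2.1 + (if bit then 2 ^ (q.2.1 : ℕ) else 0), q.2.2.2)
    else
      (⟨q.1 + 1, by omega⟩, 0, 0,
        Function.update q.2.2.2 q.1 (q.2.2.1 + (if bit then 2 ^ (q.2.1 : ℕ) else 0)))
  else q

/-- The coefficients that the help message contains. -/
def parse (p N b : ℕ) (w : List Bool) : Fin (N + 1) × Fin (b + 1) × ZMod p × (ℕ → ZMod p) :=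
  w.foldl (parseStep N b) (0, 0, 0, 0)

/-- The memory of the verifier: the number of complete coefficients, the number of bits of the
current one, its value so far, the value at `r` of the polynomial of the help, and the values at
`r` of the polynomials of the output set and of the graph. -/
abbrev Memory (s N b p : ℕ) : Type :=
  Fin (N + 1) × Fin (b + 1) × ZMod p × ZMod p × (Fin s → ZMod p) × (Fin s → ZMod p)

/-- The streaming form of `parseStep`: a complete coefficient is not stored but folded into the
evaluations at `r`. Bits after the last coefficient are ignored. -/
def hear (n t s N b : ℕ) (r : ZMod p) (q : Memory s N b p) (bit : Bool) :
    Memory s N b p × List (Fin n) :=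
  let x := q.2.2.1 + if bit then 2 ^ (q.2.1 : ℕ) else 0
  if hi : (q.1 : ℕ) < N then
    if hj : (q.2.1 : ℕ) < b then
      ((q.1, ⟨q.2.1 + 1, by omega⟩, x, q.2.2.2), [])
    else
      ((⟨q.1 + 1, by omega⟩, 0, 0, q.2.2.2.1 + x * r ^ (q.1 : ℕ),
        q.2.2.2.2.1 + outMass t s r (emit n t q.1 x), q.2.2.2.2.2), emit n t q.1 x)
  else (q, [])

/-- The verifier for maximal independent sets. -/
abbrev verifier (n t s N b p : ℕ) [Fact p.Prime] : Verifier (EdgeUpdate n) (Fin n) where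
  Coins := ZMod p
  State := Memory s N b p
  init _ := (0, 0, 0, 0, 0, 0)
  read r q a := (q.1, q.2.1, q.2.2.1, q.2.2.2.1, q.2.2.2.2.1, fun y => q.2.2.2.2.2 y +
    (a.Δ : ZMod p) * (edgeWeight t s r y a.u a.v + edgeWeight t s r y a.v a.u))
  hear := hear n t s N b
  finish _ q :=
    if (q.1 : ℕ) = N ∧ q.2.2.2.1 = ∑ y, q.2.2.2.2.2 y * q.2.2.2.2.1 y then some [] else none

theorem outMass_append (t s : ℕ) (r : ZMod p) (l l' : List (Fin n)) :
    outMass t s r (l ++ l') = outMass t s r l + outMass t s r l' := by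
  funext y
  simp [outMass]

theorem emitted_succ_update (t i : ℕ) (c : ℕ → ZMod p) (x : ZMod p) :
    emitted n t (i + 1) (Function.update c i x) = emitted n t i c ++ emit n t i x := by
  rw [emitted, List.range_succ, List.flatMap_append]
  congr 1
  · refine List.flatMap_congr fun k hk => ?_
    rw [Function.update_of_ne (List.mem_range.1 hk).ne]
  · simp

/-- The memory that belongs to a state of the parser. -/
def memory (n t s N b : ℕ) (r : ZMod p) (P : Fin s → ZMod p)
    (q : Fin (N + 1) × Fin (b + 1) × ZMod p × (ℕ → ZMod p)) : Memory s N b p :=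
  (q.1, q.2.1, q.2.2.1, ∑ k ∈ Finset.range q.1, q.2.2.2 k * r ^ k,
    outMass t s r (emitted n t q.1 q.2.2.2), P)

/-- The parser keeps every coefficient and never sees `r`; the real memory is its image under
`memory`. This is the hypothesis of `out_of_simulation`. -/
theorem hear_memory (t s N b : ℕ) (r : ZMod p) (P : Fin s → ZMod p)
    (q : Fin (N + 1) × Fin (b + 1) × ZMod p × (ℕ → ZMod p)) (bit : Bool) :
    memory n t s N b r P (parseStep N b q bit) =
        (hear n t s N b r (memory n t s N b r P q) bit).1 ∧
      emitted n t (parseStep N b q bit).1 (parseStep N b q bit).2.2.2 =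
        emitted n t q.1 q.2.2.2 ++ (hear n t s N b r (memory n t s N b r P q) bit).2 := by
  obtain ⟨i, j, cur, c⟩ := q
  by_cases hi : (i : ℕ) < N
  · by_cases hj : (j : ℕ) < b
    · simp [parseStep, hear, memory, hi, hj]
    · have hsum : ∀ x : ZMod p, ∑ k ∈ Finset.range i, Function.update c i x k * r ^ k =
          ∑ k ∈ Finset.range i, c k * r ^ k := fun x =>
        Finset.sum_congr rfl fun k hk => by
          rw [Function.update_of_ne (Finset.mem_range.1 hk).ne]
      simp [parseStep, hear, memory, hi, hj, emitted_succ_update, outMass_append,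
        Finset.sum_range_succ, hsum]
  · simp [parseStep, hear, memory, hi]

/-- The polynomials of the graph, evaluated at `r`. -/
def graphMass (t s : ℕ) (r : ZMod p) (σ : List (EdgeUpdate n)) (y : Fin s) : ZMod p :=
  ∑ v, ∑ u, (edgeMult σ s(v, u) : ZMod p) * edgeWeight t s r y v u

theorem summary_verifier (t s N b : ℕ) [Fact p.Prime] (r : ZMod p) (σ : List (EdgeUpdate n))
    (hσ : ∀ a ∈ σ, a.u ≠ a.v) :
    (verifier n t s N b p).summary r σ = (0, 0, 0, 0, 0, graphMass t s r σ) := by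
  have key : ∀ (σ : List (EdgeUpdate n)) (P : Fin s → ZMod p),
      σ.foldl ((verifier n t s N b p).read r) ((0, 0, 0, 0, 0, P) : Memory s N b p) =
        ((0, 0, 0, 0, 0, fun y => P y + (σ.map fun a => (a.Δ : ZMod p) *
          (edgeWeight t s r y a.u a.v + edgeWeight t s r y a.v a.u)).sum) : Memory s N b p) := by
    intro σ
    induction σ with
    | nil =>
      intro P
      rw [List.foldl_nil]
      simp
    | cons a σ ih =>
      intro P
      rw [List.foldl_cons]
      refine (ih _).trans ?_
      simp [verifier, add_assoc]
  refine (key σ 0).trans ?_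
  have : (fun y : Fin s => (0 : Fin s → ZMod p) y + (σ.map fun a => (a.Δ : ZMod p) *
      (edgeWeight t s r y a.u a.v + edgeWeight t s r y a.v a.u)).sum) = graphMass t s r σ := by
    funext y
    rw [graphMass, sum_edgeMult_mul _ _ hσ]
    simp
  rw [this]

-- The coins decide only about acceptance: what is output is fixed by the help. Soundness rests on
-- this separation.
open Classical in
theorem result_verifier (t s N b : ℕ) [Fact p.Prime] (r : ZMod p) (σ : List (EdgeUpdate n))
    (hσ : ∀ a ∈ σ, a.u ≠ a.v) (w : List Bool) :
    (verifier n t s N b p).result r σ w =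
      if ((parse p N b w).1 : ℕ) = N ∧
          ∑ k ∈ Finset.range N, (parse p N b w).2.2.2 k * r ^ k =
            ∑ y, graphMass t s r σ y *
              outMass t s r (emitted n t N (parse p N b w).2.2.2) y
      then some (emitted n t N (parse p N b w).2.2.2) else none := by
  have h := Verifier.out_of_simulation (verifier n t s N b p) r (parseStep N b)
    (memory n t s N b r (graphMass t s r σ)) (fun q => emitted n t q.1 q.2.2.2)
    (fun q bit => (hear_memory t s N b r _ q bit).1)
    (fun q bit => (hear_memory t s N b r (graphMass t s r σ) q bit).2) w (0, 0, 0, 0)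
  have h0 : memory n t s N b r (graphMass t s r σ) (0, 0, 0, 0) =
      ((0, 0, 0, 0, 0, graphMass t s r σ) : Memory s N b p) := by
    have : outMass t s r ([] : List (Fin n)) = 0 := by funext y; simp [outMass]
    simp [memory, emitted, this]
  unfold Verifier.result
  rw [summary_verifier t s N b r σ hσ, ← h0]
  have hid : ∀ o : Option (List (Fin n)),
      o.map (emitted n t ((0 : Fin (N + 1)) : ℕ) (0 : ℕ → ZMod p) ++ ·) = o := by
    intro o; simp [emitted]
  rw [← hid (Verifier.out _ _ _ _)]
  refine h.trans ?_
  change Option.map _ (if _ then _ else _) = _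
  simp only [memory]
  rw [← parse]
  by_cases hN : ((parse p N b w).1 : ℕ) = N
  · simp only [hN]
    split_ifs <;> simp
  · simp [hN]

end MISScheme

/-! ### The product polynomial and the encoding of the help -/

namespace MISScheme

variable {n p : ℕ}

theorem mem_emit {t k : ℕ} {x : ZMod p} {v : Fin n} :
    v ∈ emit n t k x ↔ (k / (2 * t) = v ∧ k % (2 * t) = t - 1) ∧ x = 0 := by
  unfold emit
  split_ifs with h h'
  · simp [Fin.ext_iff, h', eq_comm]
  · simp only [List.not_mem_nil, false_iff]
    tauto
  · simp only [List.not_mem_nil, false_iff]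
    rintro ⟨⟨hk, _⟩, _⟩
    exact h (hk ▸ v.2)

theorem mem_emitted {t : ℕ} (ht : 1 ≤ t) (c : ℕ → ZMod p) (v : Fin n) :
    v ∈ emitted n t (n * (2 * t)) c ↔ c (2 * t * v + (t - 1)) = 0 := by
  simp only [emitted, List.mem_flatMap, List.mem_range, mem_emit]
  constructor
  · rintro ⟨k, -, ⟨h1, h2⟩, h3⟩
    rwa [← h1, ← h2, Nat.div_add_mod]
  · intro h
    refine ⟨2 * t * v + (t - 1), ?_, ⟨?_, ?_⟩, h⟩
    · calc 2 * t * v + (t - 1) < 2 * t * (v + 1) := by rw [mul_add]; omega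
        _ ≤ 2 * t * n := Nat.mul_le_mul_left _ v.2
        _ = n * (2 * t) := mul_comm _ _
    · rw [Nat.mul_add_div (by omega), Nat.div_eq_of_lt (by omega), add_zero]
    · rw [Nat.mul_add_mod, Nat.mod_eq_of_lt (by omega)]

/-- The index `k` is recovered from the vertex, being `2tv + t-1`. Without repetitions the mass of
the output list is a sum over its set. -/
theorem nodup_emitted (t i : ℕ) (c : ℕ → ZMod p) : (emitted n t i c).Nodup := by
  rw [emitted, List.nodup_flatMap]
  constructor
  · intro k _
    unfold emit
    split_ifs <;> simp
  · refine List.nodup_range.imp_of_mem fun {k k'} _ _ hne => ?_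
    intro v hv hv'
    rw [mem_emit] at hv hv'
    apply hne
    rw [← Nat.div_add_mod k (2 * t), ← Nat.div_add_mod k' (2 * t), hv.1.1, hv.1.2, hv'.1.1,
      hv'.1.2]

open Polynomial

/-- The polynomial whose coefficients are the help message. -/
noncomputable def claimPoly (N : ℕ) (c : ℕ → ZMod p) : (ZMod p)[X] :=
  ∑ k ∈ Finset.range N, C (c k) * X ^ k

/-- The polynomial whose coefficients the help message should be if the output set is `U`. -/
noncomputable def targetPoly (t s : ℕ) (A : Fin n → Fin n → ZMod p) (U : Finset (Fin n)) :
    (ZMod p)[X] :=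
  ∑ v : Fin n, ∑ u : Fin n, ∑ u' ∈ U, if (u : ℕ) % s = u' % s then
    C (A v u) * X ^ (2 * t * v + u / s + (t - 1 - u' / s)) else 0

theorem coeff_claimPoly {N : ℕ} (c : ℕ → ZMod p) {k : ℕ} (hk : k < N) :
    (claimPoly N c).coeff k = c k := by
  simp [claimPoly, coeff_X_pow, hk]

theorem natDegree_claimPoly_lt {N : ℕ} (hN : 0 < N) (c : ℕ → ZMod p) :
    (claimPoly N c).natDegree < N := by
  have : (claimPoly N c).natDegree ≤ N - 1 := by
    refine natDegree_sum_le_of_forall_le _ _ fun k hk => ?_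
    have := Finset.mem_range.1 hk
    exact (natDegree_C_mul_X_pow_le _ _).trans (by omega)
  omega

theorem div_lt_of_le_mul {t s : ℕ} (hts : n ≤ t * s) (u : Fin n) : (u : ℕ) / s < t :=
  Nat.div_lt_of_lt_mul (by rw [mul_comm]; exact u.2.trans_le hts)

theorem natDegree_targetPoly_lt {t s : ℕ} (hn : 1 ≤ n) (ht : 1 ≤ t) (hts : n ≤ t * s)
    (A : Fin n → Fin n → ZMod p) (U : Finset (Fin n)) :
    (targetPoly t s A U).natDegree < n * (2 * t) := by
  have h0 : 0 < n * (2 * t) := by positivity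
  have : (targetPoly t s A U).natDegree ≤ n * (2 * t) - 1 := by
    refine natDegree_sum_le_of_forall_le _ _ fun v _ =>
      natDegree_sum_le_of_forall_le _ _ fun u _ => natDegree_sum_le_of_forall_le _ _ fun u' _ => ?_
    split_ifs
    · refine (natDegree_C_mul_X_pow_le _ _).trans ?_
      have h1 := div_lt_of_le_mul hts u
      have h2 : 2 * t * (v + 1) ≤ 2 * t * n := Nat.mul_le_mul_left _ v.2
      rw [mul_add, mul_comm (2 * t) n] at h2
      generalize (u : ℕ) / s = x at *
      generalize (u' : ℕ) / s = x' at *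
      omega
    · simp
  omega

/-- Within a residue class the offset `u/s + (t-1-u'/s)` equals `t-1` only for `u = u'`, so the
convolution picks out the inner product of row `v` with the indicator of `U`. -/
theorem coeff_targetPoly {t s : ℕ} (hs : s ≠ 0) (hts : n ≤ t * s)
    (A : Fin n → Fin n → ZMod p) (U : Finset (Fin n)) (v : Fin n) :
    (targetPoly t s A U).coeff (2 * t * v + (t - 1)) = ∑ u ∈ U, A v u := by
  have hterm : ∀ v' u u' : Fin n, (if (u : ℕ) % s = u' % s then
      C (A v' u) * X ^ (2 * t * v' + u / s + (t - 1 - u' / s)) else 0 : (ZMod p)[X]).coeff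
        (2 * t * v + (t - 1)) = if v' = v then if u = u' then A v u' else 0 else 0 := by
    intro v' u u'
    have hu := div_lt_of_le_mul hts u
    have hu' := div_lt_of_le_mul hts u'
    have key : (u : ℕ) % s = u' % s →
        (2 * t * (v : ℕ) + (t - 1) = 2 * t * v' + u / s + (t - 1 - u' / s) ↔ v' = v ∧ u = u') := by
      intro hmod
      have hdm := Nat.div_add_mod (u : ℕ) s
      have hdm' := Nat.div_add_mod (u' : ℕ) s
      rw [hmod] at hdm
      generalize (u : ℕ) / s = x at *
      generalize (u' : ℕ) / s = x' at *
      constructor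
      · intro h
        -- The offsets lie between `0` and `2t-2`, so blocks of length `2t` do not overlap.
        have hv : (v' : ℕ) = v := by
          rcases lt_trichotomy (v' : ℕ) v with hlt | heq | hlt
          · have h2 : 2 * t * (v' + 1) ≤ 2 * t * v := Nat.mul_le_mul_left _ hlt
            rw [mul_add] at h2
            omega
          · exact heq
          · have h2 : 2 * t * (v + 1) ≤ 2 * t * v' := Nat.mul_le_mul_left _ hlt
            rw [mul_add] at h2
            omega
        rw [hv] at h
        have hdiv : x = x' := by omega
        refine ⟨Fin.ext hv, Fin.ext ?_⟩
        rw [← hdm, hdiv, hdm']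
      · rintro ⟨rfl, rfl⟩
        have : x = x' := Nat.eq_of_mul_eq_mul_left (Nat.pos_of_ne_zero hs) (by omega)
        omega
    split_ifs with hmod h1 h2
    · rw [coeff_C_mul, coeff_X_pow, if_pos ((key hmod).2 ⟨h1, h2⟩), mul_one, h1, h2]
    · rw [coeff_C_mul, coeff_X_pow, if_neg fun h => h2 ((key hmod).1 h).2, mul_zero]
    · rw [coeff_C_mul, coeff_X_pow, if_neg fun h => h1 ((key hmod).1 h).1, mul_zero]
    · rename_i h2
      exact (hmod (by rw [h2])).elim
    · simp
    · simp
  simp only [targetPoly, finsetSum_coeff, hterm]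
  rw [Finset.sum_eq_single v]
  · rw [Finset.sum_comm]
    simp
  · intro b _ hb
    simp [hb]
  · simp

theorem eval_targetPoly (t : ℕ) {s : ℕ} (hs : 1 ≤ s) (r : ZMod p) (σ : List (EdgeUpdate n))
    (l : List (Fin n)) (hl : l.Nodup) :
    ∑ y, graphMass t s r σ y * outMass t s r l y =
      (targetPoly t s (fun v u => (edgeMult σ s(v, u) : ZMod p)) l.toFinset).eval r := by
  have hout : ∀ y, outMass t s r l y =
      ∑ v ∈ l.toFinset, if (v : ℕ) % s = y then r ^ (t - 1 - v / s) else 0 := fun y => by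
    rw [outMass, List.sum_toFinset _ hl]
  simp only [hout, graphMass, targetPoly, eval_finsetSum, Finset.sum_mul, Finset.mul_sum]
  calc _ = ∑ v, ∑ y : Fin s, ∑ u, ∑ u' ∈ l.toFinset,
        (edgeMult σ s(v, u) : ZMod p) * edgeWeight t s r y v u *
          (if (u' : ℕ) % s = y then r ^ (t - 1 - u' / s) else 0) := ?_
    _ = _ := ?_
  · simp_rw [Finset.sum_comm (s := l.toFinset)]
    rw [Finset.sum_comm]
  refine Finset.sum_congr rfl fun v _ => ?_
  rw [Finset.sum_comm]
  refine Finset.sum_congr rfl fun u _ => ?_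
  rw [Finset.sum_comm]
  refine Finset.sum_congr rfl fun u' _ => ?_
  -- Only the residue class of `u` contributes.
  rw [Finset.sum_eq_single (⟨u % s, Nat.mod_lt _ hs⟩ : Fin s)]
  · by_cases h : (u : ℕ) % s = u' % s
    · simp [edgeWeight, h, pow_add, mul_assoc]
    · simp [h, Ne.symm h]
  · intro y _ hy
    have : (u : ℕ) % s ≠ y := fun h => hy (Fin.ext h.symm)
    simp [edgeWeight, this]
  · simp

/-- The probability that a nonzero polynomial of small degree vanishes at a random point. -/
theorem card_isRoot_le [Fact p.Prime] (f : (ZMod p)[X]) (hf : f ≠ 0) (E : ZMod p → Prop)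
    (hE : ∀ r, E r → f.eval r = 0) : Nat.card {r // E r} ≤ f.natDegree := by
  classical
  calc Nat.card {r // E r} = (Finset.univ.filter E).card := by
        rw [Nat.card_eq_fintype_card, Fintype.card_subtype]
    _ ≤ f.roots.toFinset.card := by
        refine Finset.card_le_card fun r hr => ?_
        simp only [Finset.mem_filter, Finset.mem_univ, true_and] at hr
        simp [hf, hE r hr]
    _ ≤ f.natDegree := (Multiset.toFinset_card_le _).trans (card_roots' f)

theorem mod_two_pow_succ (x m : ℕ) :
    x % 2 ^ (m + 1) = x % 2 ^ m + if x.testBit m then 2 ^ m else 0 := by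
  rw [Nat.mod_pow_succ, Nat.testBit_eq_decide_div_mod_eq]
  rcases Nat.mod_two_eq_zero_or_one (x / 2 ^ m) with h | h <;> simp [h]

theorem foldl_parseStep_range {N b : ℕ} (i : Fin (N + 1)) (hi : (i : ℕ) < N) (c : ℕ → ZMod p)
    (x : ℕ) : ∀ m (hm : m < b + 1),
      ((List.range m).map x.testBit).foldl (parseStep N b) (i, 0, 0, c) =
        (i, ⟨m, hm⟩, ((x % 2 ^ m : ℕ) : ZMod p), c) := by
  intro m
  induction m with
  | zero => intro hm; simp [Nat.mod_one]
  | succ m ih =>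
    intro hm
    rw [List.range_succ, List.map_append, List.foldl_append, ih (by omega)]
    have hb : m < b := by omega
    simp only [List.map_cons, List.map_nil, List.foldl_cons, List.foldl_nil, parseStep, hi, hb,
      dif_pos, mod_two_pow_succ]
    cases x.testBit m
    · simp only [Bool.false_eq_true, if_false, add_zero]
    · simp only [if_true, Nat.cast_add, Nat.cast_pow, Nat.cast_ofNat]

theorem foldl_parseStep_coefficient {N b : ℕ} (i : Fin (N + 1)) (hi : (i : ℕ) < N)
    (c : ℕ → ZMod p) {x : ℕ} (hx : x < 2 ^ (b + 1)) :
    ((List.range (b + 1)).map x.testBit).foldl (parseStep N b) (i, 0, 0, c) =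
      (⟨i + 1, by omega⟩, 0, 0, Function.update c i (x : ZMod p)) := by
  rw [List.range_succ, List.map_append, List.foldl_append,
    foldl_parseStep_range i hi c x b (by omega)]
  have hx' : x % 2 ^ b + (if x.testBit b = true then 2 ^ b else 0) = x := by
    rw [← mod_two_pow_succ, Nat.mod_eq_of_lt hx]
  simp only [List.map_cons, List.map_nil, List.foldl_cons, List.foldl_nil, parseStep, hi,
    dif_pos, lt_self_iff_false, dif_neg, not_false_eq_true]
  congr 4
  conv_rhs => rw [← hx']
  push_cast
  congr 1

/-- Every sequence of coefficients has a help message. -/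
theorem exists_parse_eq [Fact p.Prime] (N b : ℕ) (hp : p ≤ 2 ^ (b + 1)) (c : ℕ → ZMod p) :
    ∃ w : List Bool, w.length = N * (b + 1) ∧ ((parse p N b w).1 : ℕ) = N ∧
      ∀ k < N, (parse p N b w).2.2.2 k = c k := by
  have key : ∀ i (hi : i < N + 1), ∃ w : List Bool, w.length = i * (b + 1) ∧ ∃ c',
      parse p N b w = (⟨i, hi⟩, 0, 0, c') ∧ ∀ k < i, c' k = c k := by
    intro i
    induction i with
    | zero => exact fun _ => ⟨[], by simp, 0, rfl, by simp⟩
    | succ i ih =>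
      intro hi
      obtain ⟨w, hw, c', hc', hk⟩ := ih (by omega)
      refine ⟨w ++ (List.range (b + 1)).map (c i).val.testBit, by simp [hw]; ring,
        Function.update c' i (c i), ?_, ?_⟩
      · rw [parse, List.foldl_append, ← parse, hc', foldl_parseStep_coefficient _
          (by simpa using hi) _ ((ZMod.val_lt (c i)).trans_le hp)]
        simp
      · intro k hki
        rcases Nat.lt_succ_iff_lt_or_eq.1 hki with h | rfl
        · rw [Function.update_of_ne h.ne, hk k h]
        · simp
  obtain ⟨w, hw, c', hc', hk⟩ := key N (by omega)
  exact ⟨w, hw, by rw [hc'], by rw [hc']; exact hk⟩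

end MISScheme

/-! ### Completeness, soundness and cost of the scheme -/

namespace MISScheme

variable {n p : ℕ}

open Polynomial

/-- The sum is a neighbour count of at most `n < p`, so it vanishes modulo `p` only if it is zero.
-/
theorem natCast_edgeMult_sum [Fact p.Prime] {σ : List (EdgeUpdate n)} {G : SimpleGraph (Fin n)}
    (hσ : TurnstileStream σ G) (hp : n < p) (U : Finset (Fin n)) (v : Fin n) :
    ∑ u ∈ U, (edgeMult σ s(v, u) : ZMod p) = 0 ↔ ∀ u ∈ U, ¬ G.Adj v u := by
  classical
  have hterm : ∀ u, (edgeMult σ s(v, u) : ZMod p) = if G.Adj v u then 1 else 0 := by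
    intro u
    split_ifs with h
    · rw [(hσ.2 _).1 (by simpa using h), Int.cast_one]
    · rw [(hσ.2 _).2 (by simpa using h), Int.cast_zero]
  simp only [hterm, Finset.sum_boole]
  have hlt : (U.filter fun u => G.Adj v u).card < p :=
    ((Finset.card_le_univ _).trans_eq (Fintype.card_fin n)).trans_lt hp
  rw [ZMod.natCast_eq_zero_iff]
  constructor
  · intro h
    have := Nat.eq_zero_of_dvd_of_lt h hlt
    rwa [Finset.card_eq_zero, Finset.filter_eq_empty_iff] at this
  · intro h
    rw [Finset.filter_eq_empty_iff.2 h]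
    simp

theorem listsMIS_iff (G : SimpleGraph (Fin n)) (l : List (Fin n)) :
    ListsMIS G l ↔ ∀ v, v ∈ l ↔ ∀ u ∈ l.toFinset, ¬ G.Adj v u := by
  rw [ListsMIS, maximal_isIndepSet_iff]
  simp

theorem exists_maximal_isIndepSet (G : SimpleGraph (Fin n)) :
    ∃ U : Finset (Fin n), ∀ v, v ∈ U ↔ ∀ u ∈ U, ¬ G.Adj v u := by
  classical
  obtain ⟨U, -, hU⟩ := Finite.exists_le_maximal
    (p := fun U : Set (Fin n) => G.IsIndepSet U) (a := ∅) (by simp)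
  refine ⟨U.toFinset, ?_⟩
  simpa using (maximal_isIndepSet_iff G U).1 hU

theorem sum_range_claim (N : ℕ) (c : ℕ → ZMod p) (r : ZMod p) :
    ∑ k ∈ Finset.range N, c k * r ^ k = (claimPoly N c).eval r := by
  simp [claimPoly, eval_finsetSum]

theorem isScheme_verifier {t s b : ℕ} [Fact p.Prime] (hn : 1 ≤ n) (ht : 1 ≤ t) (hs : 1 ≤ s)
    (hts : n ≤ t * s) (hp : 6 * (n * t) ≤ p) (hpb : p ≤ 2 ^ (b + 1)) :
    (verifier n t s (n * (2 * t)) b p).IsScheme TurnstileStream ListsMIS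
      (n * (2 * t) * (b + 1)) 0 (1 / 3) := by
  classical
  set N := n * (2 * t) with hN
  have hNpos : 0 < N := by positivity
  have hnp : n < p := by nlinarith
  intro σ G hσ
  set A : Fin n → Fin n → ZMod p := fun v u => (edgeMult σ s(v, u) : ZMod p) with hA
  have hidx : ∀ v : Fin n, 2 * t * (v : ℕ) + (t - 1) < N := by
    intro v
    have h2 : 2 * t * (v + 1) ≤ 2 * t * n := Nat.mul_le_mul_left _ v.2
    rw [mul_add, mul_comm (2 * t) n] at h2
    omega
  have hmem : ∀ (c : ℕ → ZMod p) (v : Fin n),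
      v ∈ emitted n t N c ↔ c (2 * t * v + (t - 1)) = 0 := mem_emitted ht
  constructor
  · obtain ⟨U, hU⟩ := exists_maximal_isIndepSet G
    obtain ⟨w, hw, hi, hc⟩ := exists_parse_eq N b hpb (targetPoly t s A U).coeff
    refine ⟨w, hw.le, ?_⟩
    have hl : ∀ v, v ∈ emitted n t N (parse p N b w).2.2.2 ↔ v ∈ U := by
      intro v
      rw [hmem, hc _ (hidx v), coeff_targetPoly (by omega) hts, hU]
      exact natCast_edgeMult_sum hσ hnp U v
    have hl' : (emitted n t N (parse p N b w).2.2.2).toFinset = U := by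
      ext v; rw [List.mem_toFinset, hl]
    have hall : ∀ r : ZMod p, ∃ l, (verifier n t s N b p).result r σ w = some l ∧
        ListsMIS G l := by
      intro r
      refine ⟨_, (result_verifier t s N b r σ hσ.1 w).trans (if_pos ⟨hi, ?_⟩), ?_⟩
      rotate_left
      · rw [eval_targetPoly t hs r σ _ (nodup_emitted t N _), hl', sum_range_claim]
        congr 1
        ext k
        by_cases hk : k < N
        · rw [coeff_claimPoly _ hk, hc k hk]
        · rw [coeff_eq_zero_of_natDegree_lt ((natDegree_claimPoly_lt hNpos _).trans_le
            (not_lt.1 hk)), coeff_eq_zero_of_natDegree_lt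
            ((natDegree_targetPoly_lt hn ht hts _ _).trans_le (not_lt.1 hk))]
      · rw [listsMIS_iff, hl']
        intro v
        rw [hl, hU]
    rw [sub_zero, Verifier.prob, Nat.card_congr (Equiv.subtypeUnivEquiv hall),
      Nat.card_eq_fintype_card, div_self]
    exact Nat.cast_ne_zero.2 Fintype.card_ne_zero
  · intro w
    set c := (parse p N b w).2.2.2 with hc
    set l : List (Fin n) := emitted n t N c with hl
    have hcard : Nat.card {r : ZMod p // ∃ l, (verifier n t s N b p).result r σ w = some l ∧
        ¬ ListsMIS G l} ≤ N := by
      by_cases hmis : ListsMIS G l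
      · have : IsEmpty {r : ZMod p // ∃ l, (verifier n t s N b p).result r σ w = some l ∧
            ¬ ListsMIS G l} := by
          refine ⟨fun ⟨r, l', h1, h2⟩ => h2 ?_⟩
          have h := (result_verifier t s N b r σ hσ.1 w).symm.trans h1
          split_ifs at h
          rw [← Option.some.inj h]
          exact hmis
        simp
      -- If the two polynomials agreed, the claimed counts would be the true ones for the output
      -- set, which would then be a maximal independent set.
      · have hne : claimPoly N c - targetPoly t s A l.toFinset ≠ 0 := by
          intro h0
          apply hmis
          rw [listsMIS_iff]
          intro v
          rw [hmem, ← coeff_claimPoly c (hidx v), sub_eq_zero.1 h0,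
            coeff_targetPoly (by omega) hts]
          exact natCast_edgeMult_sum hσ hnp _ v
        refine (card_isRoot_le _ hne _ ?_).trans ((natDegree_sub_le _ _).trans (max_le
          (natDegree_claimPoly_lt hNpos _).le (natDegree_targetPoly_lt hn ht hts _ _).le))
        rintro r ⟨l', h1, -⟩
        have h := (result_verifier t s N b r σ hσ.1 w).symm.trans h1
        split_ifs at h with hcond
        rw [eval_sub, sub_eq_zero, ← sum_range_claim, hcond.2,
          eval_targetPoly t hs r σ _ (nodup_emitted t N _)]
    have hcoins : Fintype.card (verifier n t s N b p).Coins = p := ZMod.card p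
    rw [Verifier.prob, hcoins]
    have hppos : (0 : ℝ) < p := by exact_mod_cast (Fact.out : p.Prime).pos
    rw [div_le_iff₀ hppos]
    have h3 : ((3 * N : ℕ) : ℝ) ≤ p := by
      exact_mod_cast (by rw [hN]; linarith : 3 * N ≤ p)
    have h4 : (Nat.card {r : ZMod p // ∃ l, (verifier n t s N b p).result r σ w = some l ∧
        ¬ ListsMIS G l} : ℝ) ≤ N := by exact_mod_cast hcard
    push_cast at h3
    refine h4.trans ?_
    linarith

theorem usesSpace_verifier {t s N b : ℕ} [Fact p.Prime] (hs : 1 ≤ s) (hN : N < p)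
    (hpb : p ≤ 2 ^ (b + 1)) : (verifier n t s N b p).UsesSpace (7 * s * (b + 1)) := by
  have hcard : Fintype.card (verifier n t s N b p).State =
      (N + 1) * ((b + 1) * (p * (p * (p ^ s * p ^ s)))) := by
    change Fintype.card (Memory s N b p) = _
    simp [ZMod.card]
  rw [Verifier.UsesSpace, hcard]
  have hb : b + 1 ≤ 2 ^ (b + 1) := Nat.lt_two_pow_self.le
  calc (N + 1) * ((b + 1) * (p * (p * (p ^ s * p ^ s))))
      ≤ 2 ^ (b + 1) * (2 ^ (b + 1) * (2 ^ (b + 1) * (2 ^ (b + 1) *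
          ((2 ^ (b + 1)) ^ s * (2 ^ (b + 1)) ^ s)))) := by
        gcongr
        omega
    _ = 2 ^ ((2 * s + 4) * (b + 1)) := by
        rw [← pow_mul]
        ring
    _ ≤ 2 ^ (7 * s * (b + 1)) := by
        apply Nat.pow_le_pow_right (by norm_num)
        apply Nat.mul_le_mul_right
        omega

theorem exists_scheme : ∃ C k : ℕ, ∀ n t s : ℕ, 1 ≤ n → 1 ≤ t → 1 ≤ s → n ≤ t * s →
    ∃ V : Verifier (EdgeUpdate n) (Fin n),
      V.UsesSpace (C * s * (Nat.log 2 n + 1) ^ k) ∧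
      V.UsesCoins (C * s * (Nat.log 2 n + 1) ^ k) ∧
      V.IsScheme TurnstileStream ListsMIS (C * (n * t) * (Nat.log 2 n + 1) ^ k) 0 (1 / 3) := by
  refine ⟨42, 1, fun n t s hn ht hs hts => ?_⟩
  rw [pow_one]
  set L := Nat.log 2 n + 1 with hL
  have hnL : n < 2 ^ L := Nat.lt_pow_succ_log_self (by norm_num) n
  -- Capping `t` at `n` keeps `p`, of order `n * t'`, polynomial in `n`, so that a coefficient takes
  -- `O(log n)` bits even if `t` is huge.
  set t' := min t n with ht'
  have ht'1 : 1 ≤ t' := le_min ht hn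
  have ht't : t' ≤ t := min_le_left _ _
  have ht'n : t' ≤ n := min_le_right _ _
  have hts' : n ≤ t' * s := by
    rcases min_choice t n with h | h
    · rw [ht', h]; exact hts
    · rw [ht', h]; exact Nat.le_mul_of_pos_right n hs
  obtain ⟨p, hp, hlt, hle⟩ := Nat.exists_prime_lt_and_le_two_mul (6 * (n * t'))
    (by positivity)
  have : Fact p.Prime := ⟨hp⟩
  have hpb : p ≤ 2 ^ (2 * L + 3 + 1) := by
    calc p ≤ 2 * (6 * (n * t')) := hle
      _ ≤ 2 * (6 * (2 ^ L * 2 ^ L)) := by gcongr; exact ht'n.trans hnL.le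
      _ ≤ 2 ^ (2 * L + 3 + 1) := by
        have : 2 ^ (2 * L + 3 + 1) = 16 * (2 ^ L * 2 ^ L) := by ring
        omega
  have hb : 2 * L + 3 + 1 ≤ 6 * L := by omega
  have hspace : 7 * s * (2 * L + 3 + 1) ≤ 42 * s * L := by nlinarith
  refine ⟨verifier n t' s (n * (2 * t')) (2 * L + 3) p, ?_, ?_, ?_⟩
  · refine (usesSpace_verifier hs (by linarith) hpb).trans ?_
    exact Nat.pow_le_pow_right (by norm_num) hspace
  · rw [Verifier.UsesCoins]
    refine (ZMod.card p).le.trans (hpb.trans (Nat.pow_le_pow_right (by norm_num) ?_))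
    nlinarith
  · intro σ G hσ
    obtain ⟨⟨w, hw, h1⟩, h2⟩ :=
      isScheme_verifier hn ht'1 hs hts' hlt.le hpb σ G hσ
    refine ⟨⟨w, hw.trans ?_, h1⟩, h2⟩
    calc n * (2 * t') * (2 * L + 3 + 1) ≤ n * (2 * t) * (6 * L) := by gcongr
      _ = 12 * (n * t) * L := by ring
      _ ≤ 42 * (n * t) * L := by gcongr; norm_num

end MISScheme

/-! ### Index problem: amplification and counting of codes -/

namespace IndexBound

open Finset

/-- If an event has probability at most `1/3`, then it rarely happens in half of `2j` independent
trials. -/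
theorem card_half_le {C : Type*} [Fintype C] (E : C → Prop)
    [DecidablePred E] (hE : 3 * #{c | E c} ≤ Fintype.card C) (j : ℕ) :
    9 ^ j * #{ρ : Fin (2 * j) → C | j ≤ #{a | E (ρ a)}} ≤ 8 ^ j * Fintype.card C ^ (2 * j) := by
  -- Markov's inequality for the exponential moment `2 ^ #{a | E (ρ a)}`, which factors over the
  -- independent trials.
  have h1 : 2 ^ j * #{ρ : Fin (2 * j) → C | j ≤ #{a | E (ρ a)}} ≤
      ∑ ρ : Fin (2 * j) → C, ∏ a, (if E (ρ a) then 2 else 1) := by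
    rw [mul_comm, ← smul_eq_mul, ← Finset.sum_const]
    refine (Finset.sum_le_sum fun ρ hρ => ?_).trans
      (Finset.sum_le_sum_of_subset (Finset.subset_univ _))
    rw [Finset.prod_ite, Finset.prod_const, Finset.prod_const_one, mul_one]
    exact Nat.pow_le_pow_right (by norm_num) (Finset.mem_filter.1 hρ).2
  have h2 : ∑ ρ : Fin (2 * j) → C, ∏ a, (if E (ρ a) then 2 else 1) =
      (Fintype.card C + #{c | E c}) ^ (2 * j) := by
    rw [← Fintype.piFinset_univ, Finset.sum_prod_piFinset univ fun _ c => if E c then 2 else 1]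
    have : ∑ c : C, (if E c then 2 else 1) = Fintype.card C + #{c | E c} := by
      have : ∀ c : C, (if E c then 2 else 1) = 1 + if E c then 1 else 0 := by
        intro c; split_ifs <;> rfl
      simp [this, Finset.sum_add_distrib]
    simp [this]
  -- Each factor has mean at most `4/3`; the bound becomes `(16/9)^j / 2^j = (8/9)^j`.
  have h3 : 9 ^ j * (Fintype.card C + #{c | E c}) ^ (2 * j) ≤
      16 ^ j * Fintype.card C ^ (2 * j) := by
    have : (3 * (Fintype.card C + #{c | E c})) ^ (2 * j) ≤ (4 * Fintype.card C) ^ (2 * j) :=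
      Nat.pow_le_pow_left (by omega) _
    rw [mul_pow, mul_pow, pow_mul 3, pow_mul 4] at this
    exact this
  have h4 : (16 : ℕ) ^ j = 2 ^ j * 8 ^ j := by rw [← mul_pow]; norm_num
  rw [h2] at h1
  refine Nat.le_of_mul_le_mul_left (c := 2 ^ j) ?_ (by positivity)
  calc 2 ^ j * (9 ^ j * #{ρ : Fin (2 * j) → C | j ≤ #{a | E (ρ a)}})
      = 9 ^ j * (2 ^ j * #{ρ : Fin (2 * j) → C | j ≤ #{a | E (ρ a)}}) := by ring
    _ ≤ 9 ^ j * (Fintype.card C + #{c | E c}) ^ (2 * j) := Nat.mul_le_mul_left _ h1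
    _ ≤ 16 ^ j * Fintype.card C ^ (2 * j) := h3
    _ = 2 ^ j * (8 ^ j * Fintype.card C ^ (2 * j)) := by rw [h4]; ring

open Classical in
/-- A code from which nearly all bits can be recovered on average has many code words. -/
theorem two_pow_le_of_decoder {K M : Type*} [Fintype K] [Fintype M] (enc : (K → Bool) → M)
    (dec : M → K → Bool)
    (herr : 16 * #{q : (K → Bool) × K | dec (enc q.1) q.2 ≠ q.1 q.2} ≤
      2 ^ Fintype.card K * Fintype.card K) :
    2 ^ (2 * Fintype.card K) ≤ 2 ^ 8 * Fintype.card M ^ 8 := by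
  set N := Fintype.card K with hN
  -- This is `⌈7N/8⌉`. By Markov at least half of all `x` are decoded correctly in that many
  -- positions.
  set e := (7 * N + 7) / 8 with he
  let wrong (x : K → Bool) : ℕ := #{κ | dec (enc x) κ ≠ x κ}
  let agree (m : M) (x : K → Bool) : ℕ := #{κ | dec m κ = x κ}
  have hagree : ∀ x, agree (enc x) x + wrong x = N := fun x =>
    (Finset.card_filter_add_card_filter_not _).trans Finset.card_univ
  have hsum : #{q : (K → Bool) × K | dec (enc q.1) q.2 ≠ q.1 q.2} = ∑ x, wrong x := by
    simp only [wrong, Finset.card_filter]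
    rw [← Finset.univ_product_univ, Finset.sum_product]
  rw [hsum] at herr
  have hbad : 2 * #{x | N < 8 * wrong x} ≤ 2 ^ N := by
    rcases Nat.eq_zero_or_pos N with h0 | hpos
    · have : #{x : K → Bool | N < 8 * wrong x} = 0 := by
        rw [Finset.card_eq_zero, Finset.filter_eq_empty_iff]
        intro x _
        have := hagree x
        omega
      rw [this]
      exact Nat.zero_le _
    · have h1 : #{x | N < 8 * wrong x} * N ≤ ∑ x, 8 * wrong x := by
        rw [← smul_eq_mul, ← Finset.sum_const]
        exact (Finset.sum_le_sum fun x hx => (Finset.mem_filter.1 hx).2.le).trans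
          (Finset.sum_le_sum_of_subset (Finset.subset_univ _))
      rw [← Finset.mul_sum] at h1
      refine Nat.le_of_mul_le_mul_right (c := N) ?_ hpos
      linarith
  have hcount : #{x | N < 8 * wrong x} + #{x | ¬ N < 8 * wrong x} = 2 ^ N := by
    rw [Finset.card_filter_add_card_filter_not, Finset.card_univ]
    simp [hN]
  have h1 : #{x | ¬ N < 8 * wrong x} * 2 ^ e ≤ Fintype.card M * 3 ^ N := by
    calc #{x | ¬ N < 8 * wrong x} * 2 ^ e
        ≤ ∑ x, 2 ^ agree (enc x) x := by
          rw [← smul_eq_mul, ← Finset.sum_const]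
          refine (Finset.sum_le_sum fun x hx => ?_).trans
            (Finset.sum_le_sum_of_subset (Finset.subset_univ _))
          have := (Finset.mem_filter.1 hx).2
          have := hagree x
          exact Nat.pow_le_pow_right (by norm_num) (by omega)
      _ ≤ ∑ x, ∑ m, 2 ^ agree m x := Finset.sum_le_sum fun x _ =>
          Finset.single_le_sum (f := fun m => 2 ^ agree m x) (fun _ _ => Nat.zero_le _)
            (Finset.mem_univ (enc x))
      -- For a fixed code word, each position contributes a factor `2 + 1` to the sum over `x`.
      _ = ∑ m : M, 3 ^ N := by
          rw [Finset.sum_comm]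
          refine Finset.sum_congr rfl fun m _ => ?_
          have : ∀ x, 2 ^ agree m x = ∏ κ, if dec m κ = x κ then 2 else 1 := by
            intro x
            rw [Finset.prod_ite, Finset.prod_const, Finset.prod_const_one, mul_one]
          simp only [this]
          rw [← Fintype.piFinset_univ,
            Finset.sum_prod_piFinset univ fun κ b => if dec m κ = b then 2 else 1]
          have h3 : ∀ κ, ∑ b : Bool, (if dec m κ = b then 2 else 1) = 3 := by
            intro κ; cases dec m κ <;> rfl
          simp only [h3, Finset.prod_const, Finset.card_univ, hN]
      _ = Fintype.card M * 3 ^ N := by simp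
  have h2 : 2 ^ N * 2 ^ e ≤ 2 * (Fintype.card M * 3 ^ N) := by
    refine le_trans ?_ (Nat.mul_le_mul_left 2 h1)
    rw [← mul_assoc]
    exact Nat.mul_le_mul_right _ (by omega)
  have h3 : (2 ^ N * 2 ^ e) ^ 8 ≤ (2 * (Fintype.card M * 3 ^ N)) ^ 8 := Nat.pow_le_pow_left h2 8
  have h4 : 2 ^ (15 * N) ≤ (2 ^ N * 2 ^ e) ^ 8 := by
    rw [← pow_add, ← pow_mul]
    exact Nat.pow_le_pow_right (by norm_num) (by omega)
  -- Uses `3 ^ 8 ≤ 2 ^ 13`.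
  have h5 : (2 * (Fintype.card M * 3 ^ N)) ^ 8 ≤ 2 ^ 8 * Fintype.card M ^ 8 * 2 ^ (13 * N) := by
    rw [mul_pow, mul_pow, ← mul_assoc, ← pow_mul, mul_comm N 8, pow_mul, pow_mul]
    exact Nat.mul_le_mul_left _ (Nat.pow_le_pow_left (by norm_num) N)
  refine Nat.le_of_mul_le_mul_right (c := 2 ^ (13 * N)) ?_ (by positivity)
  rw [← pow_add]
  refine le_trans ?_ ((h4.trans h3).trans h5)
  exact Nat.pow_le_pow_right (by norm_num) (by omega)

open Classical in
/-- The lower bound for one-way protocols with help for the index problem: the message depends on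
the coins `c` and on `x`, and the receiver, who knows the index `κ`, votes for the bit `1`
depending on the help `w`. -/
theorem card_le_of_protocol {K C S W : Type} [Fintype K] [Fintype C] [Nonempty C] [Fintype S]
    [Fintype W] (enc : C → (K → Bool) → S) (vote : K → C → S → W → Prop)
    (hcomplete : ∀ x κ, x κ = true → ∃ w, 3 * #{c | ¬ vote κ c (enc c x) w} ≤ Fintype.card C)
    (hsound : ∀ x κ, x κ = false → ∀ w, 3 * #{c | vote κ c (enc c x) w} ≤ Fintype.card C)
    (j : ℕ) (hj : 16 * (Fintype.card W * 8 ^ j) ≤ 9 ^ j) (hW : 1 ≤ Fintype.card W) :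
    2 ^ (2 * Fintype.card K) ≤ 2 ^ 8 * (Fintype.card S ^ (2 * j)) ^ 8 := by
  -- The decoder says `1` if some help wins a strict majority of the `2j` runs. A wrong answer needs
  -- at least half of the runs to err: on the one good help if the bit is `1`, on some help if it is
  -- `0`, whence the union bound over `W`.
  let dec (ρ : Fin (2 * j) → C) (m : Fin (2 * j) → S) (κ : K) : Bool :=
    decide (∃ w, j < #{a | vote κ (ρ a) (m a) w})
  let msg (ρ : Fin (2 * j) → C) (x : K → Bool) : Fin (2 * j) → S := fun a => enc (ρ a) x
  set T := Fintype.card C ^ (2 * j) with hT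
  have hTpos : 0 < T := pow_pos Fintype.card_pos _
  have herr : ∀ x κ, 9 ^ j * #{ρ | dec ρ (msg ρ x) κ ≠ x κ} ≤
      Fintype.card W * (8 ^ j * T) := by
    intro x κ
    cases hx : x κ with
    | true =>
      obtain ⟨w, hw⟩ := hcomplete x κ hx
      refine le_trans ?_ ((card_half_le _ hw j).trans (Nat.le_mul_of_pos_left _ hW))
      refine Nat.mul_le_mul_left _ (Finset.card_le_card fun ρ hρ => ?_)
      simp only [Finset.mem_filter, Finset.mem_univ, true_and, dec, ne_eq, decide_eq_true_eq,
        not_exists, not_lt] at hρ ⊢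
      have h1 := hρ w
      have h2 := Finset.card_filter_add_card_filter_not (s := (univ : Finset (Fin (2 * j))))
        (fun a => vote κ (ρ a) (enc (ρ a) x) w)
      simp only [Finset.card_univ, Fintype.card_fin] at h2
      change #{a | vote κ (ρ a) (enc (ρ a) x) w} ≤ j at h1
      omega
    | false =>
      have hsub : ({ρ | dec ρ (msg ρ x) κ ≠ false} : Finset (Fin (2 * j) → C)) ⊆
          univ.biUnion fun w => {ρ | j ≤ #{a | vote κ (ρ a) (enc (ρ a) x) w}} := by
        intro ρ hρ
        simp only [Finset.mem_filter, Finset.mem_univ, true_and, dec, ne_eq,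
          Bool.not_eq_false, decide_eq_true_eq] at hρ
        obtain ⟨w, hw⟩ := hρ
        simp only [Finset.mem_biUnion, Finset.mem_filter, Finset.mem_univ, true_and]
        exact ⟨w, hw.le⟩
      calc 9 ^ j * #{ρ | dec ρ (msg ρ x) κ ≠ false}
          ≤ 9 ^ j * ∑ w : W, #{ρ : Fin (2 * j) → C | j ≤ #{a | vote κ (ρ a) (enc (ρ a) x) w}} :=
            Nat.mul_le_mul_left _ ((Finset.card_le_card hsub).trans Finset.card_biUnion_le)
        _ ≤ ∑ w : W, 8 ^ j * T := by
            rw [Finset.mul_sum]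
            exact Finset.sum_le_sum fun w _ => card_half_le _ (hsound x κ hx w) j
        _ = Fintype.card W * (8 ^ j * T) := by simp
  have herr' : ∀ x κ, 16 * #{ρ | dec ρ (msg ρ x) κ ≠ x κ} ≤ T := by
    intro x κ
    refine Nat.le_of_mul_le_mul_left (c := 9 ^ j) ?_ (by positivity)
    calc 9 ^ j * (16 * #{ρ | dec ρ (msg ρ x) κ ≠ x κ})
        = 16 * (9 ^ j * #{ρ | dec ρ (msg ρ x) κ ≠ x κ}) := by ring
      _ ≤ 16 * (Fintype.card W * (8 ^ j * T)) := Nat.mul_le_mul_left _ (herr x κ)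
      _ = 16 * (Fintype.card W * 8 ^ j) * T := by ring
      _ ≤ 9 ^ j * T := Nat.mul_le_mul_right _ hj
  -- Averaging fixes the coins of all runs, so their number costs nothing.
  obtain ⟨ρ, -, hρ⟩ : ∃ ρ ∈ (univ : Finset (Fin (2 * j) → C)),
      16 * #{q : (K → Bool) × K | dec ρ (msg ρ q.1) q.2 ≠ q.1 q.2} ≤
        2 ^ Fintype.card K * Fintype.card K := by
    refine Finset.exists_le_of_sum_le Finset.univ_nonempty ?_
    rw [← Finset.mul_sum]
    have hswap : ∑ ρ : Fin (2 * j) → C,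
        #{q : (K → Bool) × K | dec ρ (msg ρ q.1) q.2 ≠ q.1 q.2} =
        ∑ q : (K → Bool) × K, #{ρ | dec ρ (msg ρ q.1) q.2 ≠ q.1 q.2} := by
      simp only [Finset.card_filter]
      exact Finset.sum_comm
    rw [hswap, Finset.mul_sum]
    refine (Finset.sum_le_sum fun q _ => herr' q.1 q.2).trans ?_
    simp [hT]
    exact le_of_eq (by ring)
  have := two_pow_le_of_decoder (msg ρ) (dec ρ) hρ
  simpa using this

end IndexBound

/-! ### Reduction from the index problem to maximal independent sets -/

namespace IndexReduction

open Classical in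
/-- A vanilla stream of a graph. -/
noncomputable def edgeStream {n : ℕ} (G : SimpleGraph (Fin n)) : List (EdgeUpdate n) :=
  G.edgeFinset.toList.map fun e => ⟨(Quot.out e).1, (Quot.out e).2, 1⟩

theorem mk_out {α : Type*} (e : Sym2 α) : s((Quot.out e).1, (Quot.out e).2) = e := Quot.out_eq e

theorem vanillaStream_edgeStream {n : ℕ} (G : SimpleGraph (Fin n)) :
    VanillaStream (edgeStream G) G := by
  classical
  have hmult : ∀ e, edgeMult (edgeStream G) e = if e ∈ G.edgeSet then 1 else 0 := by
    intro e
    simp only [edgeMult, edgeStream, List.map_map, Function.comp_def, mk_out]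
    rw [Finset.sum_map_toList]
    simp
  refine ⟨⟨?_, fun e => ?_⟩, ?_⟩
  · intro a ha
    obtain ⟨e, he, rfl⟩ := List.mem_map.1 ha
    have he' : e ∈ G.edgeSet := by simpa using he
    rw [← mk_out e, SimpleGraph.mem_edgeSet] at he'
    exact he'.ne
  · rw [hmult]
    constructor <;> intro h <;> simp [h]
  · intro a ha
    obtain ⟨e, -, rfl⟩ := List.mem_map.1 ha
    rfl

theorem VanillaStream.append {n : ℕ} {σ τ : List (EdgeUpdate n)} {G H : SimpleGraph (Fin n)}
    (hσ : VanillaStream σ G) (hτ : VanillaStream τ H) (hGH : Disjoint G H) :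
    VanillaStream (σ ++ τ) (G ⊔ H) := by
  have hmult : ∀ e, edgeMult (σ ++ τ) e = edgeMult σ e + edgeMult τ e := by
    intro e; simp [edgeMult]
  have hdisj := SimpleGraph.disjoint_edgeSet.2 hGH
  refine ⟨⟨?_, fun e => ?_⟩, ?_⟩
  · intro a ha
    rcases List.mem_append.1 ha with h | h
    · exact hσ.1.1 a h
    · exact hτ.1.1 a h
  · rw [hmult, SimpleGraph.edgeSet_sup]
    constructor
    · rintro (h | h)
      · rw [(hσ.1.2 e).1 h, (hτ.1.2 e).2 (Set.disjoint_left.1 hdisj h), add_zero]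
      · rw [(hσ.1.2 e).2 (Set.disjoint_right.1 hdisj h), (hτ.1.2 e).1 h, zero_add]
    · intro h
      rw [(hσ.1.2 e).2 fun h' => h (Or.inl h'), (hτ.1.2 e).2 fun h' => h (Or.inr h'), add_zero]
  · intro a ha
    rcases List.mem_append.1 ha with h | h
    · exact hσ.2 a h
    · exact hτ.2 a h

variable {m : ℕ}

/-- Two copies of a graph with two sides of `m` vertices each: a vertex is given by its copy, its
side, and its number. -/
abbrev Vert (m : ℕ) : Type := Bool × Bool × Fin m

/-- Two copies of the bipartite graph whose non-edges are the pairs `κ` with `x κ = true`. -/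
def dataGraph (x : Fin m × Fin m → Bool) : SimpleGraph (Vert m) :=
  SimpleGraph.fromRel fun a b =>
    a.1 = b.1 ∧ a.2.1 = false ∧ b.2.1 = true ∧ x (a.2.2, b.2.2) = false

/-- The vertices that stand for the two ends of the pair `κ`. -/
def IsEnd (κ : Fin m × Fin m) (a : Vert m) : Prop :=
  a.2 = (false, κ.1) ∨ a.2 = (true, κ.2)

/-- All edges between the two copies, except those at the ends of `κ`. -/
def queryGraph (κ : Fin m × Fin m) : SimpleGraph (Vert m) :=
  SimpleGraph.fromRel fun a b => a.1 = false ∧ b.1 = true ∧ ¬ IsEnd κ a ∧ ¬ IsEnd κ b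

/-- Data edges stay inside a copy, query edges cross. Hence the concatenated stream lists no edge
twice. -/
theorem disjoint_dataGraph_queryGraph (x : Fin m × Fin m → Bool) (κ : Fin m × Fin m) :
    Disjoint (dataGraph x) (queryGraph κ) := by
  rw [disjoint_iff]
  ext a b
  simp only [SimpleGraph.inf_adj, SimpleGraph.bot_adj, iff_false, not_and]
  rintro ⟨-, h⟩ ⟨-, h'⟩
  have h1 : a.1 = b.1 := by
    rcases h with h | h
    · exact h.1
    · exact h.1.symm
  rcases h' with ⟨h2, h3, -⟩ | ⟨h2, h3, -⟩
  · rw [h1, h3] at h2; exact absurd h2 (by decide)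
  · rw [← h1, h3] at h2; exact absurd h2 (by decide)

/-- A maximal independent set reveals whether the pair `κ` is an edge. -/
theorem exists_copy_iff {x : Fin m × Fin m → Bool} {κ : Fin m × Fin m} {U : Set (Vert m)}
    (hU : ∀ v, v ∈ U ↔ ∀ u ∈ U, ¬ (dataGraph x ⊔ queryGraph κ).Adj v u) :
    (∃ c, (c, false, κ.1) ∈ U ∧ (c, true, κ.2) ∈ U) ↔ x κ = true := by
  constructor
  · rintro ⟨c, h1, h2⟩
    by_contra hx
    rw [Bool.not_eq_true] at hx
    refine (hU _).1 h1 _ h2 (Or.inl ⟨by simp, Or.inl ⟨rfl, rfl, rfl, hx⟩⟩)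
  -- Non-ends of `U` in both copies would be joined by a query edge.
  · intro hx
    obtain ⟨c, hc⟩ : ∃ c, ∀ u ∈ U, u.1 = c → IsEnd κ u := by
      by_contra! hcon
      obtain ⟨u, hu, hu1, hu2⟩ := hcon false
      obtain ⟨u', hu', hu1', hu2'⟩ := hcon true
      refine (hU u).1 hu u' hu' (Or.inr ⟨?_, Or.inl ⟨hu1, hu1', hu2, hu2'⟩⟩)
      rintro rfl
      rw [hu1] at hu1'
      exact absurd hu1' (by decide)
    -- Query edges avoid ends, and a data neighbour in `U` would be the other end of `κ`, which is a
    -- non-edge.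
    have hmem : ∀ a : Vert m, a.1 = c → IsEnd κ a → a ∈ U := by
      rintro ⟨_, d, i⟩ rfl ha
      rw [hU]
      rintro ⟨c', d', i'⟩ hu (⟨-, h⟩ | ⟨-, h⟩)
      · rcases h with ⟨h1, h2, h3, h4⟩ | ⟨h1, h2, h3, h4⟩
        · have hend := hc _ hu h1.symm
          simp only [IsEnd, Prod.mk.injEq] at *
          grind
        · have hend := hc _ hu h1
          simp only [IsEnd, Prod.mk.injEq] at *
          grind
      · rcases h with ⟨-, -, h, -⟩ | ⟨-, -, -, h⟩ <;> exact h ha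
    exact ⟨c, hmem _ rfl (Or.inl rfl), hmem _ rfl (Or.inr rfl)⟩

variable {n : ℕ} (f : Vert m ↪ Fin n)

/-- The output `l` says that the pair `κ` is not an edge. -/
def Reveals (κ : Fin m × Fin m) (l : List (Fin n)) : Prop :=
  ∃ c, f (c, false, κ.1) ∈ l ∧ f (c, true, κ.2) ∈ l

/-- Vertices outside the image of `f` are isolated, so the preimage of the output satisfies the same
characterization on `Vert m`. -/
theorem reveals_iff {x : Fin m × Fin m → Bool} {κ : Fin m × Fin m} {l : List (Fin n)}
    (hl : ListsMIS ((dataGraph x).map f ⊔ (queryGraph κ).map f) l) :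
    Reveals f κ l ↔ x κ = true := by
  have h := (maximal_isIndepSet_iff _ _).1 hl
  refine exists_copy_iff (U := {a | f a ∈ l}) fun v => ?_
  refine (h (f v)).trans ?_
  simp only [SimpleGraph.sup_adj, SimpleGraph.map_adj, Set.mem_ofPred_eq]
  constructor
  · intro h' u hu hadj
    refine h' (f u) hu (hadj.imp (fun h => ⟨v, u, h, rfl, rfl⟩) fun h => ⟨v, u, h, rfl, rfl⟩)
  · rintro h' u hu (⟨a, b, hab, hav, rfl⟩ | ⟨a, b, hab, hav, rfl⟩)
    · rw [f.injective hav] at hab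
      exact h' b hu (Or.inl hab)
    · rw [f.injective hav] at hab
      exact h' b hu (Or.inr hab)

theorem vanillaStream_append_edgeStream (x : Fin m × Fin m → Bool) (κ : Fin m × Fin m) :
    VanillaStream (edgeStream ((dataGraph x).map f) ++ edgeStream ((queryGraph κ).map f))
      ((dataGraph x).map f ⊔ (queryGraph κ).map f) := by
  refine VanillaStream.append (vanillaStream_edgeStream _) (vanillaStream_edgeStream _) ?_
  rw [disjoint_iff]
  ext v w
  simp only [SimpleGraph.inf_adj, SimpleGraph.bot_adj, iff_false, not_and, SimpleGraph.map_adj]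
  rintro ⟨a, b, hab, rfl, rfl⟩ ⟨a', b', hab', ha, hb⟩
  rw [f.injective ha, f.injective hb] at hab'
  have : (dataGraph x ⊓ queryGraph κ).Adj a b := ⟨hab, hab'⟩
  rw [disjoint_iff.1 (disjoint_dataGraph_queryGraph x κ)] at this
  exact this

/-- The help messages of at most `h` bits. -/
abbrev Help (h : ℕ) : Type := Σ k : Fin (h + 1), List.Vector Bool k

theorem card_help (h : ℕ) : Fintype.card (Help h) + 1 = 2 ^ (h + 1) := by
  rw [Fintype.card_sigma]
  simp only [card_vector, Fintype.card_bool]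
  rw [Fin.sum_univ_eq_sum_range (fun k => 2 ^ k) (h + 1)]
  have := Nat.geomSum_eq (le_refl 2) (h + 1)
  rw [this]
  have : 1 ≤ 2 ^ (h + 1) := Nat.one_le_two_pow
  omega

open Classical in
theorem prob_le_iff {α β : Type} (V : Verifier α β) (E : V.Coins → Prop) :
    V.prob E ≤ 1 / 3 ↔ 3 * (Finset.univ.filter E).card ≤ Fintype.card V.Coins := by
  have hpos : (0 : ℝ) < Fintype.card V.Coins := by exact_mod_cast Fintype.card_pos
  rw [Verifier.prob, Nat.card_eq_fintype_card, Fintype.card_subtype, div_le_iff₀ hpos,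
    ← Nat.cast_le (α := ℝ)]
  push_cast
  constructor <;> intro h <;> linarith

theorem prob_mono {α β : Type} (V : Verifier α β) {E F : V.Coins → Prop} (h : ∀ r, E r → F r) :
    V.prob E ≤ V.prob F := by
  classical
  unfold Verifier.prob
  gcongr
  rw [Nat.card_eq_fintype_card, Nat.card_eq_fintype_card]
  exact Fintype.card_subtype_mono E F h

theorem prob_not {α β : Type} (V : Verifier α β) (E : V.Coins → Prop) :
    V.prob (fun r => ¬ E r) = 1 - V.prob E := by
  classical
  have hpos : (0 : ℝ) < Fintype.card V.Coins := by exact_mod_cast Fintype.card_pos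
  have h := Fintype.card_subtype_compl E
  have h' := Fintype.card_subtype_le E
  rw [Verifier.prob, Verifier.prob, Nat.card_eq_fintype_card, Nat.card_eq_fintype_card, h,
    Nat.cast_sub h', sub_div, div_self hpos.ne']

theorem summary_append {α β : Type} (V : Verifier α β) (r : V.Coins) (σ τ : List α) :
    V.summary r (σ ++ τ) = τ.foldl (V.read r) (V.summary r σ) := by
  simp [Verifier.summary]

/-- The message is the memory after the data edges; the receiver streams the query edges and runs
the help phase. -/
theorem sq_le_of_isScheme {h v : ℕ} (f : Vert m ↪ Fin n)
    (V : Verifier (EdgeUpdate n) (Fin n)) (hv : V.UsesSpace v)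
    (hV : V.IsScheme VanillaStream ListsMIS h (1 / 3) (1 / 3)) :
    m * m ≤ 4 + 48 * ((h + 5) * v) := by
  classical
  let vote (κ : Fin m × Fin m) (r : V.Coins) (q : V.State) (w : Help h) : Prop :=
    ∃ l, V.out r ((edgeStream ((queryGraph κ).map f)).foldl (V.read r) q) w.2.1 = some l ∧
      Reveals f κ l
  let enc (r : V.Coins) (x : Fin m × Fin m → Bool) : V.State :=
    V.summary r (edgeStream ((dataGraph x).map f))
  have hresult : ∀ x κ r (w : Help h), V.out r ((edgeStream ((queryGraph κ).map f)).foldl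
      (V.read r) (enc r x)) w.2.1 = V.result r
      (edgeStream ((dataGraph x).map f) ++ edgeStream ((queryGraph κ).map f)) w.2.1 := by
    intro x κ r w
    rw [Verifier.result, summary_append]
  have hcard := card_help h
  have hWpos : 1 ≤ Fintype.card (Help h) := by
    have : 2 ^ 1 ≤ 2 ^ (h + 1) := Nat.pow_le_pow_right (by norm_num) (by omega)
    omega
  -- There are fewer than `2 ^ (h+1)` help messages and `16 * 2 ^ (h+1) = 2 ^ (h+5)`, so `2 * 8 ^ 6
  -- ≤ 9 ^ 6` makes `j = 6(h+5)` sufficient.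
  have key := IndexBound.card_le_of_protocol enc vote ?_ ?_ (6 * (h + 5)) ?_ hWpos
  · simp only [Fintype.card_prod, Fintype.card_fin] at key
    have h1 : (Fintype.card V.State ^ (2 * (6 * (h + 5)))) ^ 8 ≤ 2 ^ (96 * ((h + 5) * v)) := by
      rw [← pow_mul]
      refine (Nat.pow_le_pow_left hv _).trans ?_
      rw [← pow_mul]
      exact Nat.pow_le_pow_right (by norm_num) (le_of_eq (by ring))
    have h2 := key.trans (Nat.mul_le_mul_left _ h1)
    rw [← pow_add, Nat.pow_le_pow_iff_right (by norm_num)] at h2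
    omega
  · intro x κ hx
    obtain ⟨⟨w, hw, hp⟩, -⟩ := hV _ _ (vanillaStream_append_edgeStream f x κ)
    let w' : Help h := ⟨⟨w.length, by omega⟩, w, rfl⟩
    refine ⟨w', ?_⟩
    have hle : V.prob (fun r => ¬ vote κ r (enc r x) w') ≤ 1 / 3 := by
      rw [prob_not]
      have : 1 - 1 / 3 ≤ V.prob fun r => vote κ r (enc r x) w' :=
        hp.trans (prob_mono V fun r ⟨l, h1, h2⟩ =>
          ⟨l, (hresult x κ r w').trans h1, (reveals_iff f h2).2 hx⟩)
      linarith
    convert (prob_le_iff V _).1 hle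
  · intro x κ hx w
    obtain ⟨-, hp⟩ := hV _ _ (vanillaStream_append_edgeStream f x κ)
    have hle : V.prob (fun r => vote κ r (enc r x) w) ≤ 1 / 3 := by
      refine (prob_mono V ?_).trans (hp w.2.1)
      rintro r ⟨l, h1, h2⟩
      refine ⟨l, (hresult x κ r w).symm.trans h1, fun h3 => ?_⟩
      rw [reveals_iff f h3, hx] at h2
      exact absurd h2 (by decide)
    convert (prob_le_iff V _).1 hle
  · calc 16 * (Fintype.card (Help h) * 8 ^ (6 * (h + 5)))
        ≤ 2 ^ 4 * (2 ^ (h + 1) * 8 ^ (6 * (h + 5))) := by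
          gcongr
          · norm_num
          · omega
      _ = (2 * 8 ^ 6) ^ (h + 5) := by
          rw [mul_pow, ← pow_mul, ← mul_assoc, ← pow_add]
          congr 2
          omega
      _ ≤ (9 ^ 6) ^ (h + 5) := Nat.pow_le_pow_left (by norm_num) _
      _ = 9 ^ (6 * (h + 5)) := by rw [← pow_mul]

/-- A verifier without memory cannot distinguish the empty graph from the complete graph. -/
theorem space_pos_of_isScheme {h v : ℕ} (hn : 2 ≤ n) (V : Verifier (EdgeUpdate n) (Fin n))
    (hv : V.UsesSpace v) (hV : V.IsScheme VanillaStream ListsMIS h (1 / 3) (1 / 3)) :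
    1 ≤ v := by
  by_contra hv0
  obtain rfl : v = 0 := by omega
  have hsub : Subsingleton V.State := Fintype.card_le_one_iff_subsingleton.1 (by simpa [Verifier.UsesSpace] using hv)
  obtain ⟨⟨w, -, h1⟩, -⟩ := hV _ _ (vanillaStream_edgeStream (⊥ : SimpleGraph (Fin n)))
  obtain ⟨-, h2⟩ := hV _ _ (vanillaStream_edgeStream (⊤ : SimpleGraph (Fin n)))
  have h3 := (h1.trans (prob_mono V ?_)).trans (h2 w)
  · norm_num at h3
  · rintro r ⟨l, hl, hmis⟩
    refine ⟨l, ?_, fun hmis' => ?_⟩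
    · rw [← hl, Verifier.result, Verifier.result]
      congr 1
      exact Subsingleton.elim _ _
    · have hall : ∀ v, v ∈ l := fun v => ((maximal_isIndepSet_iff _ _).1 hmis v).2 (by simp)
      exact ((maximal_isIndepSet_iff _ _).1 hmis' ⟨0, by omega⟩).1 (hall _) ⟨1, by omega⟩ (hall _)
        (by simp)

theorem exists_lower_bound : ∃ c : ℝ, 0 < c ∧ ∀ n h v : ℕ, 2 ≤ n → 1 ≤ h →
    ∀ V : Verifier (EdgeUpdate n) (Fin n),
      V.UsesSpace v →
      V.IsScheme VanillaStream ListsMIS h (1 / 3) (1 / 3) →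
      c * (n : ℝ) ^ 2 ≤ (h : ℝ) * (v : ℝ) := by
  refine ⟨1 / 15000, by norm_num, fun n h v hn hh V hv hV => ?_⟩
  -- With `h * v ≥ 1` the additive constant in `sq_le_of_isScheme` and the case `n < 4` are
  -- absorbed.
  have hvpos := space_pos_of_isScheme hn V hv hV
  have hhv : 1 ≤ h * v := Nat.mul_pos hh hvpos
  obtain ⟨f⟩ : Nonempty (Vert (n / 4) ↪ Fin n) := by
    apply Function.Embedding.nonempty_of_card_le
    simp only [Fintype.card_prod, Fintype.card_bool, Fintype.card_fin]
    omega
  have hm := sq_le_of_isScheme f V hv hV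
  have h5 : (h + 5) * v ≤ 6 * (h * v) := by nlinarith
  have hsq : n ^ 2 ≤ 15000 * (h * v) := by
    rcases Nat.eq_zero_or_pos (n / 4) with h0 | hpos
    · have : n ≤ 3 := by omega
      nlinarith
    -- Then `n² ≤ 49(4 + 48 · 6hv) ≤ 14308hv`.
    · have : n ≤ 7 * (n / 4) := by omega
      nlinarith
  have : (n : ℝ) ^ 2 ≤ 15000 * (h * v) := by exact_mod_cast hsq
  linarith

end IndexReduction

theorem mainTheorem8 :
    (∃ C k : ℕ, ∀ n t s : ℕ, 1 ≤ n → 1 ≤ t → 1 ≤ s → n ≤ t * s →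
      ∃ V : Verifier (EdgeUpdate n) (Fin n),
        V.UsesSpace (C * s * (Nat.log 2 n + 1) ^ k) ∧
        V.UsesCoins (C * s * (Nat.log 2 n + 1) ^ k) ∧
        V.IsScheme TurnstileStream ListsMIS (C * (n * t) * (Nat.log 2 n + 1) ^ k) 0 (1 / 3)) ∧
    (∃ c : ℝ, 0 < c ∧ ∀ n h v : ℕ, 2 ≤ n → 1 ≤ h →
      ∀ V : Verifier (EdgeUpdate n) (Fin n),
        V.UsesSpace v →
        V.IsScheme VanillaStream ListsMIS h (1 / 3) (1 / 3) →
        c * (n : ℝ) ^ 2 ≤ (h : ℝ) * (v : ℝ)) := by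
  exact ⟨MISScheme.exists_scheme, IndexReduction.exists_lower_bound⟩
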